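/- Let $\mathcal C_k$ be the cycle graph with vertex set $\{1,\dots,k\}$, vertex labels being read modulo $k$. The meteor process on $\mathcal C_k$ is the family of masses $\mathcal M_t=(M^v_t)_{v}$, $t\ge 0$, $M^v_t\ge 0$, defined as follows. Let $(N^v_t)_{t\ge0}$, $v\in\{1,\dots,k\}$, be independent Poisson processes with intensity $1$, jointly independent of $\mathcal M_0$. At each jump time $t$ of $N^v$ a meteor hits $v$ and the mass at $v$ is distributed equally among its neighbors: $M^v_t=0$, $M^x_t=M^x_{t-}+M^v_{t-}/d_v$ for every neighbor $x$ of $v$ (where $d_v$ is the degree of $v$), and all other masses are unchanged; between the jump times of the processes $N^v$ the masses do not change. Assume that $\sum_v M^v_0=k$ almost surely and that the process is in the stationary regime, that is, $\mathcal M_t$ has the same distribution $Q$ for all $t\ge 0$. The vertex $v$ is called a crater if $M^v_0=0$. Then, for every vertex $a$: 1. if $k\ge 3$, then $\mathbb P(M^a_0=0)=\dfrac13$; 2. if $n\ge 1$ and $k\ge n+4$, then the probability that $a+1$ is the starting point of a maximal sequence of consecutive non-craters and that this sequence has length $n$ is $$\mathbb P\bigl(M^{a}_0=M^{a+n+1}_0=0,\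 M^{i}_0>0 \text{ for } i=a+1,\dots,a+n\bigr)=\frac{n(n+3)2^{n+1}}{(n+4)!};$$ 3. if $n\ge 1$ and $k\ge n+3$, then $$\mathbb P\bigl(M^{i}_0>0 \text{ for } i=a+1,\dots,a+n\bigr)=\frac{2^{n+1}}{(n+2)!}.$$ -/

import Mathlib

open MeasureTheory ProbabilityTheory Filter Topology
open scoped NNReal

namespace MeteorProcess

section PoissonProcesses

variable {Ω : Type*} [MeasurableSpace Ω]

/-- `N` is a (right-continuous) Poisson process on `[0, ∞)` with intensity `r` under `P`. -/
structure IsPoissonProcess (r : ℝ≥0) (N : ℝ≥0 → Ω → ℕ) (P : Measure Ω) : Prop where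
  measurable : ∀ t, Measurable (N t)
  zero : ∀ᵐ ω ∂P, N 0 ω = 0
  mono : ∀ᵐ ω ∂P, Monotone fun t => N t ω
  rightCont : ∀ᵐ ω ∂P, ∀ t, ContinuousWithinAt (fun s => N s ω) (Set.Ici t) t
  indepIncrements : HasIndepIncrements N P
  law : ∀ s t, s ≤ t → HasLaw (fun ω => N t ω - N s ω) (poissonMeasure (r * (t - s))) P

end PoissonProcesses

/-- The counting path `f` jumps at time `t`, that is, `f (t-) ≠ f t`. (This is never so at
`t = 0`, where the left neighbourhood filter is trivial.) -/
def JumpsAt (f : ℝ≥0 → ℕ) (t : ℝ≥0) : Prop :=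
  ∃ᶠ s in 𝓝[<] t, f s ≠ f t

section MassProcess

variable {V : Type*} [Fintype V] [DecidableEq V] (G : SimpleGraph V) [DecidableRel G.Adj]

/-- The masses just after a meteor hits `v`, if the masses just before the hit are `m`: the soil
at `v` is distributed equally among the neighbors of `v`. -/
noncomputable def hit (v : V) (m : V → ℝ≥0) : V → ℝ≥0 := fun x =>
  if x = v then 0 else if G.Adj v x then m x + m v / G.degree v else m x

/-- The path `m` of masses evolves according to the meteors counted by the paths `n v`. -/
structure Evolves (n : V → ℝ≥0 → ℕ) (m : ℝ≥0 → V → ℝ≥0) : Prop where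
  /-- The masses do not change during a time interval in which no meteor arrives. -/
  const : ∀ s t, s ≤ t → (∀ v, n v s = n v t) → m t = m s
  /-- If a meteor hits `v` at time `t`, then the masses at time `t` arise from those just before
  time `t` (that is, from `m (t-)`, as `m` is constant just before `t`) by redistribution. -/
  jump : ∀ v t, JumpsAt (n v) t → ∀ᶠ s in 𝓝[<] t, m t = hit G v (m s)

variable {Ω : Type*} [MeasurableSpace Ω]

/-- `M` is a meteor process on the finite graph `G`, driven by the meteor arrivals `N`. -/
structure IsMeteorProcess (N : V → ℝ≥0 → Ω → ℕ) (M : ℝ≥0 → Ω → V → ℝ≥0) (P : Measure Ω) :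
    Prop where
  measurable : ∀ t, Measurable (M t)
  poisson : ∀ v, IsPoissonProcess 1 (N v) P
  /-- The arrival processes at the different vertices are jointly independent. -/
  indep : iIndepFun (fun v ω t => N v t ω) P
  /-- The arrivals are independent of the initial masses. -/
  indep_initial : IndepFun (M 0) (fun ω v t => N v t ω) P
  evolves : ∀ᵐ ω ∂P, Evolves G (fun v t => N v t ω) (fun t => M t ω)

end MassProcess

/-- There is a crater at `v`. -/
def IsCrater {V : Type*} (m : V → ℝ≥0) (v : V) : Prop := m v = 0

/-- The vertex of the circular graph with `k` vertices that has the label `j` modulo `k`. -/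
def site (k : ℕ) [NeZero k] (j : ℕ) : Fin k := Fin.ofNat k j

/-- The vertices `a + 1, …, a + n` (modulo `k`) are not craters. -/
def NonCraters {k : ℕ} [NeZero k] (m : Fin k → ℝ≥0) (a n : ℕ) : Prop :=
  ∀ i, a + 1 ≤ i → i ≤ a + n → ¬ IsCrater m (site k i)

/-- The vertex `a + 1` is the starting point of a maximal sequence of vertices that are not
craters, and this sequence has length `n`. -/
def MaximalNonCraters {k : ℕ} [NeZero k] (m : Fin k → ℝ≥0) (a n : ℕ) : Prop :=
  NonCraters m a n ∧ IsCrater m (site k a) ∧ IsCrater m (site k (a + n + 1))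

end MeteorProcess

/-! A hit empties a vertex, and any later hit on a neighbor refills it. So once a vertex and its two
neighbors have all been hit, the vertex is a crater exactly when its last hit is later than both
neighbors' last hits. The refilling could fail only if the neighbor hit were itself empty while the
vertex is empty. Two adjacent craters are almost surely absent in the stationary regime
(`IsMeteorProcess.ae_live`), because live edges stay live and spread through the connected graph.
Hence `a + 1, …, a + n` are all non-craters iff the last hit times at `a, …, a + n + 1` have no
interior local maximum (`Evolves.nonCraters_iff`). These times are i.i.d. and atomless apart from an
atom at `0`, which stands for "no hit yet" and vanishes as `t → ∞`. A sequence of distinct values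
has no interior peak iff its maximum is at an end and the rest has no interior peak, so `2 ^ (n +
1)` of the `(n + 2)!` orderings qualify (`pi_noPeak`). This gives claim 3. Claim 1 is the complement
of the case `n = 1`, and claim 2 follows by inclusion–exclusion. -/

namespace MeteorProcess

/-! ### Last jump times of counting paths -/

/-- The time of the last jump of the counting path `f` up to time `t` (`0` if there is none).
The infimum is over a countable dense set so that this is a measurable function of the path. -/
noncomputable def lastHit (f : ℝ≥0 → ℕ) (t : ℝ≥0) : ℝ≥0 :=
  ⨅ i : ℕ, if f (TopologicalSpace.denseSeq ℝ≥0 i) = f t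
    then min (TopologicalSpace.denseSeq ℝ≥0 i) t else t

/-- A counting path: monotone and right-continuous. -/
structure IsCountingPath (f : ℝ≥0 → ℕ) : Prop where
  mono : Monotone f
  rightCont : ∀ t, ContinuousWithinAt f (Set.Ici t) t

section Path

variable {f : ℝ≥0 → ℕ}

theorem lastHit_le_self (f : ℝ≥0 → ℕ) (t : ℝ≥0) : lastHit f t ≤ t := by
  refine (ciInf_le (OrderBot.bddBelow _) 0).trans ?_
  split_ifs
  · exact min_le_right _ _
  · exact le_rfl

/-- The working characterization of `lastHit`; the dense sequence plays no role after it. If `f s <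
f t`, right continuity keeps `f` below `f t` on some `[s, u)`, so every term of the infimum is at
least `min u t > s`. -/
theorem IsCountingPath.lastHit_le_iff (hf : IsCountingPath f) {s t : ℝ≥0} (hst : s ≤ t) :
    lastHit f t ≤ s ↔ f s = f t := by
  rcases hst.eq_or_lt with rfl | hlt
  · simp [lastHit_le_self]
  constructor
  · intro h
    by_contra hne
    have hlt' : f s < f t := lt_of_le_of_ne (hf.mono hst) hne
    have hev : ∀ᶠ r in 𝓝[≥] s, f r = f s := by
      have := hf.rightCont s
      rw [ContinuousWithinAt, nhds_discrete, tendsto_pure] at this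
      exact this
    obtain ⟨u, hu, hsub⟩ := mem_nhdsGE_iff_exists_Ico_subset.1 hev
    have hsu : s < u := hu
    have : min u t ≤ lastHit f t := by
      refine le_ciInf fun i => ?_
      split_ifs with hi
      · refine min_le_min_right _ ?_
        by_contra! hd
        rcases lt_or_ge (TopologicalSpace.denseSeq ℝ≥0 i) s with h1 | h1
        · have := hf.mono h1.le
          omega
        · have h2 := hsub ⟨h1, hd⟩
          simp only [Set.mem_ofPred_eq] at h2
          omega
      · exact min_le_right _ _
    have := this.trans h
    exact absurd this (not_le.2 (lt_min hsu hlt))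
  · intro h
    refine le_of_forall_gt_imp_ge_of_dense fun r hr => ?_
    obtain ⟨i, hi⟩ := (TopologicalSpace.denseRange_denseSeq ℝ≥0).exists_mem_open
      (isOpen_Ioo (a := s) (b := min r t)) (Set.nonempty_Ioo.2 (lt_min hr hlt))
    refine (ciInf_le (OrderBot.bddBelow _) i).trans ?_
    have hit : TopologicalSpace.denseSeq ℝ≥0 i < t := hi.2.trans_le (min_le_right _ _)
    have hfi : f (TopologicalSpace.denseSeq ℝ≥0 i) = f t :=
      le_antisymm (hf.mono hit.le) (h ▸ hf.mono hi.1.le)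
    rw [if_pos hfi]
    exact (min_le_left _ _).trans (hi.2.le.trans (min_le_left _ _))

theorem IsCountingPath.apply_lastHit (hf : IsCountingPath f) (t : ℝ≥0) :
    f (lastHit f t) = f t :=
  (hf.lastHit_le_iff (lastHit_le_self f t)).1 le_rfl

theorem IsCountingPath.lastHit_congr (hf : IsCountingPath f) {s t : ℝ≥0} (hst : s ≤ t)
    (h : f s = f t) : lastHit f s = lastHit f t := by
  have hts : lastHit f t ≤ s := (hf.lastHit_le_iff hst).2 h
  refine le_antisymm ?_ ?_
  · rw [hf.lastHit_le_iff hts, hf.apply_lastHit, h]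
  · rw [hf.lastHit_le_iff ((lastHit_le_self f s).trans hst), hf.apply_lastHit, h]

theorem IsCountingPath.eventually_eq (hf : IsCountingPath f) {t : ℝ≥0} (h : lastHit f t < t) :
    ∀ᶠ s in 𝓝[<] t, f s = f t := by
  filter_upwards [Ioo_mem_nhdsLT h] with s hs
  exact (hf.lastHit_le_iff hs.2.le).1 hs.1.le

theorem IsCountingPath.lastHit_of_jumpsAt (hf : IsCountingPath f) {t : ℝ≥0} (h : JumpsAt f t) :
    lastHit f t = t := by
  by_contra hne
  have := hf.eventually_eq (lt_of_le_of_ne (lastHit_le_self f t) hne)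
  obtain ⟨s, hs, hs'⟩ := (h.and_eventually this).exists
  exact hs hs'

theorem IsCountingPath.jumpsAt_of_lastHit (hf : IsCountingPath f) {t : ℝ≥0} (h0 : 0 < t)
    (h : lastHit f t = t) : JumpsAt f t := by
  have : (𝓝[<] t).NeBot := nhdsLT_neBot_of_exists_lt ⟨0, h0⟩
  refine Eventually.frequently ?_
  filter_upwards [self_mem_nhdsWithin] with s hs heq
  have hs : s < t := hs
  have := (hf.lastHit_le_iff hs.le).2 heq
  exact absurd (h ▸ this) (not_le.2 hs)

end Path

/-! ### Pathwise evolution: craters read off from last hits -/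

section Deterministic

/-- The vertices `x` and `y` are not both craters. -/
def Live {V : Type*} (m : V → ℝ≥0) (x y : V) : Prop := m x ≠ 0 ∨ m y ≠ 0

theorem Live.symm {V : Type*} {m : V → ℝ≥0} {x y : V} (h : Live m x y) : Live m y x := Or.symm h

variable {V : Type*} [Fintype V]

/-- Induction along the jump times of finitely many counting paths. -/
theorem path_induction {n : V → ℝ≥0 → ℕ} (hn : ∀ v, IsCountingPath (n v)) {s₀ : ℝ≥0}
    {p : ℝ≥0 → Prop} (base : p s₀)
    (const : ∀ s t, s₀ ≤ s → s ≤ t → (∀ v, n v s = n v t) → p s → p t)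
    (jump : ∀ v t, s₀ < t → JumpsAt (n v) t → (∀ s, s₀ ≤ s → s < t → p s) → p t) :
    ∀ t, s₀ ≤ t → p t := by
  suffices H : ∀ N t, s₀ ≤ t → ∑ v, n v t = N → p t from fun t ht => H _ t ht rfl
  intro N
  induction N using Nat.strong_induction_on with
  | _ N ih =>
  intro t ht hN
  -- `τ` is the last jump of any path in `(s₀, t]`, or `s₀` if there is none. Nothing changes on
  -- `[τ, t]`, and every time before a jump at `τ` has a strictly smaller total count.
  obtain ⟨τ, hτ⟩ : ∃ τ, τ = (Finset.univ.sup fun v => lastHit (n v) t) ⊔ s₀ := ⟨_, rfl⟩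
  have hτt : τ ≤ t := hτ ▸ sup_le (Finset.sup_le fun v _ => lastHit_le_self _ _) ht
  have hle : ∀ v, lastHit (n v) t ≤ τ := fun v =>
    (Finset.le_sup (f := fun v => lastHit (n v) t) (Finset.mem_univ v)).trans (hτ ▸ le_sup_left)
  have heq : ∀ v, n v τ = n v t := fun v => ((hn v).lastHit_le_iff hτt).1 (hle v)
  have hs₀τ : s₀ ≤ τ := hτ ▸ le_sup_right
  refine const τ t hs₀τ hτt heq ?_
  rcases hs₀τ.eq_or_lt with h | h
  · rw [← h]; exact base
  have hsup : s₀ < Finset.univ.sup fun v => lastHit (n v) t := by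
    by_contra! hc
    rw [hτ, sup_eq_right.2 hc] at h
    exact lt_irrefl _ h
  obtain ⟨v, -, hv⟩ := Finset.lt_sup_iff.1 hsup
  obtain ⟨w, -, hw⟩ := Finset.exists_mem_eq_sup Finset.univ ⟨v, Finset.mem_univ v⟩
    (fun v => lastHit (n v) t)
  have hτw : τ = lastHit (n w) t := by rw [hτ, sup_eq_left.2 hsup.le, hw]
  have hτ0 : 0 < τ := (zero_le).trans_lt h
  refine jump w τ h ((hn w).jumpsAt_of_lastHit hτ0 ?_) ?_
  · rw [(hn w).lastHit_congr hτt (heq w), hτw]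
  · intro s hs hsτ
    refine ih (∑ v, n v s) ?_ s hs rfl
    rw [← hN]
    refine Finset.sum_lt_sum (fun v _ => (hn v).mono (hsτ.le.trans hτt)) ⟨w, Finset.mem_univ w, ?_⟩
    refine lt_of_le_of_ne ((hn w).mono (hsτ.le.trans hτt)) fun hc => ?_
    have := ((hn w).lastHit_le_iff (hsτ.le.trans hτt)).2 hc
    rw [← hτw] at this
    exact absurd this (not_le.2 hsτ)

variable [DecidableEq V] {G : SimpleGraph V} [DecidableRel G.Adj]

theorem hit_self (v : V) (m : V → ℝ≥0) : hit G v m v = 0 := by simp [hit]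

theorem hit_of_adj {v x : V} (h : G.Adj v x) (m : V → ℝ≥0) :
    hit G v m x = m x + m v / G.degree v := by
  simp [hit, h, h.ne']

theorem le_hit {v x : V} (h : x ≠ v) (m : V → ℝ≥0) : m x ≤ hit G v m x := by
  unfold hit
  rw [if_neg h]
  split_ifs
  · exact le_self_add
  · exact le_rfl

theorem hit_of_not_adj {v x : V} (h : x ≠ v) (h' : ¬ G.Adj v x) (m : V → ℝ≥0) :
    hit G v m x = m x := by
  simp [hit, h, h']

theorem hit_ne_zero {x y : V} {m : V → ℝ≥0} (hxy : G.Adj x y) (h : Live m x y) :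
    hit G x m y ≠ 0 := by
  rw [hit_of_adj hxy]
  have hd : (G.degree x : ℝ≥0) ≠ 0 := by
    have : 0 < G.degree x := (G.degree_pos_iff_exists_adj x).2 ⟨y, hxy⟩
    exact_mod_cast this.ne'
  intro hc
  rw [add_eq_zero, div_eq_zero_iff] at hc
  rcases h with h | h
  · exact hc.2.elim h hd
  · exact h hc.1

theorem hit_ne_zero_of_ne {x v : V} {m : V → ℝ≥0} (hxv : x ≠ v) (h : m x ≠ 0) :
    hit G v m x ≠ 0 :=
  ((pos_iff_ne_zero.2 h).trans_le (le_hit hxv m)).ne'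

theorem Live.hit {x y : V} {m : V → ℝ≥0} (hxy : G.Adj x y) (h : Live m x y) (v : V) :
    Live (hit G v m) x y := by
  by_cases hx : x = v
  · subst hx; exact Or.inr (hit_ne_zero hxy h)
  by_cases hy : y = v
  · subst hy; exact Or.inl (hit_ne_zero hxy.symm h.symm)
  exact h.imp (hit_ne_zero_of_ne hx) (hit_ne_zero_of_ne hy)

variable {n : V → ℝ≥0 → ℕ} {m : ℝ≥0 → V → ℝ≥0}

/-- Just before a jump time, the masses are such that the hit yields the masses at that time, and
any property of all the earlier times in question holds. -/
theorem Evolves.exists_before (hm : Evolves G n m) {v : V} {s₀ t : ℝ≥0} (hs : s₀ < t)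
    (hj : JumpsAt (n v) t) {q : ℝ≥0 → Prop} (hq : ∀ᶠ s in 𝓝[<] t, q s) :
    ∃ s, s₀ ≤ s ∧ s < t ∧ m t = MeteorProcess.hit G v (m s) ∧ q s := by
  have : (𝓝[<] t).NeBot := nhdsLT_neBot_of_exists_lt ⟨s₀, hs⟩
  obtain ⟨s, ⟨h1, h2⟩, h3⟩ := ((hm.jump v t hj).and hq |>.and (Ioo_mem_nhdsLT hs)).exists
  exact ⟨s, h3.1.le, h3.2, h1, h2⟩

/-- A hit at one end of a live edge leaves mass at the other end, and a hit elsewhere empties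
neither end. -/
theorem Evolves.live_mono (hm : Evolves G n m) (hn : ∀ v, IsCountingPath (n v)) {x y : V}
    (hxy : G.Adj x y) {s t : ℝ≥0} (hst : s ≤ t) (h : Live (m s) x y) : Live (m t) x y := by
  refine path_induction hn (p := fun t => Live (m t) x y) h ?_ ?_ t hst
  · intro r t _ hrt hc hp
    rw [hm.const r t hrt hc]; exact hp
  · intro v t hst hj hp
    obtain ⟨r, h1, h2, h3, -⟩ := hm.exists_before hst hj (q := fun _ => True) (by simp)
    rw [h3]
    exact (hp r h1 h2).hit hxy v

/-- A hit at `x` leaves `y` with positive mass, so every edge at `y` is live from then on. -/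
theorem Evolves.live_spread (hm : Evolves G n m) (hn : ∀ v, IsCountingPath (n v)) {x y z : V}
    (hxy : G.Adj x y) (hyz : G.Adj y z) {s t : ℝ≥0} (hst : s ≤ t) (h : Live (m s) x y)
    (hx : n x s ≠ n x t) : Live (m t) y z := by
  refine path_induction hn (p := fun t => n x s ≠ n x t → Live (m t) y z)
    (fun h => absurd rfl h) ?_ ?_ t hst hx
  · intro r t _ hrt hc hp hne
    rw [hm.const r t hrt hc]
    exact hp (by rwa [hc x])
  · intro v t hst hj hp hne
    rcases (lastHit_le_self (n x) t).eq_or_lt with hl | hl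
    · have hjx := (hn x).jumpsAt_of_lastHit ((zero_le).trans_lt hst) hl
      obtain ⟨r, h1, h2, h3, -⟩ := hm.exists_before hst hjx (q := fun _ => True) (by simp)
      rw [h3]
      exact Or.inl (hit_ne_zero hxy (hm.live_mono hn hxy h1 h))
    · obtain ⟨r, h1, h2, h3, h4⟩ := hm.exists_before hst hj ((hn x).eventually_eq hl)
      rw [h3]
      exact (hp r h1 h2 (by rwa [h4])).hit hyz v

/-- A vertex that was hit after all of its neighbors is a crater. -/
theorem Evolves.eq_zero_of_lastHit (hm : Evolves G n m) (hn : ∀ v, IsCountingPath (n v)) {x w : V}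
    (hxw : G.Adj x w) (t : ℝ≥0)
    (h : ∀ y, G.Adj x y → lastHit (n y) t < lastHit (n x) t) : m t x = 0 := by
  refine path_induction hn (s₀ := 0)
    (p := fun t => (∀ y, G.Adj x y → lastHit (n y) t < lastHit (n x) t) → m t x = 0)
    ?_ ?_ ?_ t (zero_le) h
  -- All last hits are `0` at time `0`, so the strict inequality at the neighbor `w` is impossible.
  · intro h0
    exact absurd ((h0 w hxw).trans_le (lastHit_le_self _ _)) not_lt_zero
  · intro r t _ hrt hc hp hne
    rw [hm.const r t hrt hc]
    refine hp fun y hy => ?_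
    rw [(hn y).lastHit_congr hrt (hc y), (hn x).lastHit_congr hrt (hc x)]
    exact hne y hy
  · intro v t h0 hj hp hne
    rcases (lastHit_le_self (n x) t).eq_or_lt with hl | hl
    · have hjx := (hn x).jumpsAt_of_lastHit h0 hl
      obtain ⟨r, h1, h2, h3, -⟩ := hm.exists_before h0 hjx (q := fun _ => True) (by simp)
      rw [h3, hit_self]
    · have hev : ∀ᶠ s in 𝓝[<] t, n x s = n x t ∧ ∀ y, G.Adj x y → n y s = n y t := by
        refine ((hn x).eventually_eq hl).and (eventually_all.2 fun y => ?_)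
        by_cases hy : G.Adj x y
        · filter_upwards [(hn y).eventually_eq ((hne y hy).trans hl)] with s hs _ using hs
        · simp [hy]
      obtain ⟨r, h1, h2, h3, h4, h5⟩ := hm.exists_before h0 hj hev
      have hv := (hn v).lastHit_of_jumpsAt hj
      have hvx : x ≠ v := by rintro rfl; exact hl.ne hv
      -- The neighbors' last hits precede that of `x`, hence precede `t`, so the vertex jumping at
      -- `t` is no neighbor and sends nothing to `x`.
      have hadj : ¬ G.Adj v x := fun hvx => ((hne v hvx.symm).trans hl).ne hv
      rw [h3, hit_of_not_adj hvx hadj]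
      refine hp r h1 h2 fun y hy => ?_
      rw [(hn y).lastHit_congr h2.le (h5 y hy), (hn x).lastHit_congr h2.le h4]
      exact hne y hy

/-- A vertex that has a neighbor hit after it is not a crater. -/
theorem Evolves.ne_zero_of_lastHit (hm : Evolves G n m) (hn : ∀ v, IsCountingPath (n v)) {x y : V}
    (hxy : G.Adj x y) (h0 : Live (m 0) x y) (t : ℝ≥0)
    (h : lastHit (n x) t < lastHit (n y) t) : m t x ≠ 0 := by
  refine path_induction hn (s₀ := 0)
    (p := fun t => lastHit (n x) t < lastHit (n y) t → m t x ≠ 0)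
    ?_ ?_ ?_ t (zero_le) h
  · intro h0
    exact absurd (h0.trans_le (lastHit_le_self _ _)) not_lt_zero
  · intro r t _ hrt hc hp hne
    rw [hm.const r t hrt hc]
    refine hp ?_
    rwa [(hn y).lastHit_congr hrt (hc y), (hn x).lastHit_congr hrt (hc x)]
  · intro v t ht hj hp hne
    rcases (lastHit_le_self (n y) t).eq_or_lt with hl | hl
    · have hjy := (hn y).jumpsAt_of_lastHit ht hl
      obtain ⟨r, h1, h2, h3, -⟩ := hm.exists_before ht hjy (q := fun _ => True) (by simp)
      rw [h3]
      -- Liveness of the edge matters here: the hit at `y` either brings mass to `x` or finds mass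
      -- already there.
      exact hit_ne_zero hxy.symm (hm.live_mono hn hxy (zero_le) h0).symm
    · obtain ⟨r, h1, h2, h3, h4, h5⟩ := hm.exists_before ht hj
        (((hn x).eventually_eq (hne.trans hl)).and ((hn y).eventually_eq hl))
      have hv := (hn v).lastHit_of_jumpsAt hj
      have hvx : x ≠ v := by rintro rfl; exact (hne.trans hl).ne hv
      rw [h3]
      refine hit_ne_zero_of_ne hvx (hp r h1 h2 ?_)
      rwa [(hn y).lastHit_congr h2.le h5, (hn x).lastHit_congr h2.le h4]

end Deterministic

end MeteorProcess

/-! ### Probability that an i.i.d. sequence has no interior peak -/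

namespace MeteorProcess

section Peaks

/-- No interior position of the sequence `y` is a strict local maximum. -/
def NoPeak {m : ℕ} (y : Fin m → ℝ≥0) : Prop :=
  ∀ i j l : Fin m, i.val + 1 = j.val → j.val + 1 = l.val → ¬ (y i < y j ∧ y l < y j)

theorem measurableSet_noPeak (m : ℕ) : MeasurableSet {y : Fin m → ℝ≥0 | NoPeak y} := by
  unfold NoPeak
  simp only [Set.ofPred_forall]
  refine .iInter fun i => .iInter fun j => .iInter fun l => .iInter fun _ => .iInter fun _ => ?_
  exact ((measurableSet_lt (measurable_pi_apply i) (measurable_pi_apply j)).inter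
    (measurableSet_lt (measurable_pi_apply l) (measurable_pi_apply j))).compl

/-- The strict maximum of `y` is at `j`, and the other terms form a sequence in `A`. -/
def maxAt {m : ℕ} (j : Fin (m + 1)) (A : Set (Fin m → ℝ≥0)) : Set (Fin (m + 1) → ℝ≥0) :=
  {y | (∀ i, y (j.succAbove i) < y j) ∧ (fun i => y (j.succAbove i)) ∈ A}

theorem measurableSet_maxAt {m : ℕ} (j : Fin (m + 1)) {A : Set (Fin m → ℝ≥0)}
    (hA : MeasurableSet A) : MeasurableSet (maxAt j A) := by
  refine ((MeasurableSet.iInter fun i => measurableSet_lt (measurable_pi_apply (j.succAbove i))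
    (measurable_pi_apply j)).inter (hA.preimage (measurable_pi_lambda
      (fun (y : Fin (m + 1) → ℝ≥0) i => y (j.succAbove i)) fun i => measurable_pi_apply _))).congr ?_
  ext
  simp [maxAt]

/-- Given the maximum `x`, the other terms form a product of copies of `ν` restricted to `Iio x`.
This is again a finite measure, which is why the results below are stated for finite measures and
not only for probability measures. -/
theorem pi_maxAt {m : ℕ} (j : Fin (m + 1)) {A : Set (Fin m → ℝ≥0)} (hA : MeasurableSet A)
    (ν : Measure ℝ≥0) [IsFiniteMeasure ν] :
    Measure.pi (fun _ : Fin (m + 1) => ν) (maxAt j A) =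
      ∫⁻ x, Measure.pi (fun _ : Fin m => ν.restrict (Set.Iio x)) A ∂ν := by
  have hmp := measurePreserving_piFinSuccAbove (fun _ : Fin (m + 1) => ν) j
  set B : Set (ℝ≥0 × (Fin m → ℝ≥0)) := {p | (∀ i, p.2 i < p.1) ∧ p.2 ∈ A} with hB
  have hBm : MeasurableSet B := by
    refine ((MeasurableSet.iInter fun i => measurableSet_lt ((measurable_pi_apply i).comp
      measurable_snd) measurable_fst).inter (hA.preimage measurable_snd)).congr ?_
    ext
    simp [hB]
  have hpre : maxAt j A = MeasurableEquiv.piFinSuccAbove (fun _ => ℝ≥0) j ⁻¹' B := rfl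
  rw [hpre, hmp.measure_preimage hBm.nullMeasurableSet, Measure.prod_apply hBm]
  refine lintegral_congr fun x => ?_
  rw [← Measure.restrict_pi_pi, Measure.restrict_apply hA]
  congr 1
  ext z
  simp [hB, and_comm]

theorem pi_eq_coord {m : ℕ} {i j : Fin m} (hij : i ≠ j) (ν : Measure ℝ≥0) [IsFiniteMeasure ν]
    [NullSingletonClass ν] : Measure.pi (fun _ : Fin m => ν) {y | y i = y j} = 0 := by
  obtain _ | m := m
  · exact i.elim0
  obtain ⟨l, rfl⟩ := Fin.exists_succAbove_eq hij
  have hmp := measurePreserving_piFinSuccAbove (fun _ : Fin (m + 1) => ν) j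
  set B : Set (ℝ≥0 × (Fin m → ℝ≥0)) := {p | p.2 l = p.1} with hB
  have hBm : MeasurableSet B :=
    measurableSet_eq_fun ((measurable_pi_apply l).comp measurable_snd) measurable_fst
  have hpre : {y : Fin (m + 1) → ℝ≥0 | y (j.succAbove l) = y j} =
    MeasurableEquiv.piFinSuccAbove (fun _ => ℝ≥0) j ⁻¹' B := rfl
  rw [hpre, hmp.measure_preimage hBm.nullMeasurableSet, Measure.prod_apply hBm]
  refine (lintegral_congr fun x => ?_).trans lintegral_zero
  exact Measure.pi_hyperplane (fun _ => ν) l x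

theorem ae_injective (m : ℕ) (ν : Measure ℝ≥0) [IsFiniteMeasure ν] [NullSingletonClass ν] :
    ∀ᵐ y ∂Measure.pi (fun _ : Fin m => ν), Function.Injective y := by
  have : ∀ i j : Fin m, i ≠ j → ∀ᵐ y ∂Measure.pi (fun _ : Fin m => ν), y i ≠ y j := by
    intro i j hij
    rw [ae_iff]
    simpa using pi_eq_coord hij ν
  simp only [← ae_all_iff] at this
  filter_upwards [this] with y hy i j hij
  by_contra hne
  exact hy i j hne hij

theorem maxAt_disjoint {m : ℕ} {A B : Set (Fin m → ℝ≥0)} {i j : Fin (m + 1)} (hij : i ≠ j) :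
    Disjoint (maxAt i A) (maxAt j B) := by
  rw [Set.disjoint_left]
  rintro y ⟨h1, -⟩ ⟨h2, -⟩
  obtain ⟨a, ha⟩ := Fin.exists_succAbove_eq hij
  obtain ⟨b, hb⟩ := Fin.exists_succAbove_eq hij.symm
  have := h1 b
  have h3 := h2 a
  rw [hb] at this
  rw [ha] at h3
  exact lt_asymm this h3

theorem exists_mem_maxAt {m : ℕ} {y : Fin (m + 1) → ℝ≥0} (hy : Function.Injective y) :
    ∃ j, y ∈ maxAt j Set.univ := by
  obtain ⟨j, -, hj⟩ := Finset.exists_max_image Finset.univ y ⟨0, Finset.mem_univ 0⟩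
  exact ⟨j, fun i => lt_of_le_of_ne (hj _ (Finset.mem_univ _))
    fun h => Fin.succAbove_ne j i (hy h), trivial⟩

/-- For an atomless measure, each position is equally likely to be that of the maximum. -/
theorem lintegral_Iio_pow (m : ℕ) (ν : Measure ℝ≥0) [IsFiniteMeasure ν] [NullSingletonClass ν] :
    ((m + 1 : ℕ) : ENNReal) * ∫⁻ x, ν (Set.Iio x) ^ m ∂ν = ν Set.univ ^ (m + 1) := by
  have h1 : ∀ j : Fin (m + 1), Measure.pi (fun _ : Fin (m + 1) => ν) (maxAt j Set.univ) =
      ∫⁻ x, ν (Set.Iio x) ^ m ∂ν := by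
    intro j
    rw [pi_maxAt j .univ]
    simp [Measure.pi_univ]
  have h2 : Measure.pi (fun _ : Fin (m + 1) => ν) (⋃ j, maxAt j Set.univ) =
      ∑ j : Fin (m + 1), ∫⁻ x, ν (Set.Iio x) ^ m ∂ν := by
    rw [measure_iUnion (fun i j hij => maxAt_disjoint hij)
      (fun j => measurableSet_maxAt j .univ), tsum_fintype]
    exact Finset.sum_congr rfl fun j _ => h1 j
  have h3 : Measure.pi (fun _ : Fin (m + 1) => ν) (⋃ j, maxAt j Set.univ) =
      Measure.pi (fun _ : Fin (m + 1) => ν) Set.univ := by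
    refine measure_congr ?_
    filter_upwards [ae_injective (m + 1) ν] with y hy
    exact eq_true (Set.mem_iUnion.2 (exists_mem_maxAt hy)) |>.trans (eq_true trivial).symm
  rw [h2, Measure.pi_univ] at h3
  simpa using h3

/-- An interior maximum would be a peak. Deleting a maximum at an end keeps the remaining neighbors
consecutive, and putting it back creates no peak, since the term next to it is smaller than it. -/
theorem noPeak_iff {m : ℕ} {y : Fin (m + 2) → ℝ≥0} (hy : Function.Injective y) :
    NoPeak y ↔ y ∈ maxAt 0 {z | NoPeak z} ∪ maxAt (Fin.last (m + 1)) {z | NoPeak z} := by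
  constructor
  · intro h
    obtain ⟨j, hj, -⟩ := exists_mem_maxAt hy
    have hj' : ∀ i, i ≠ j → y i < y j := fun i hi => by
      obtain ⟨a, rfl⟩ := Fin.exists_succAbove_eq hi
      exact hj a
    rcases Fin.eq_zero_or_eq_succ j with rfl | ⟨j, rfl⟩
    · left
      refine ⟨hj, fun a b c hab hbc => ?_⟩
      exact h _ _ _ (by simpa using hab) (by simpa using hbc)
    · rcases Fin.eq_castSucc_or_eq_last j.succ with ⟨c, hc⟩ | hc
      · exfalso
        have hv : j.val + 1 = c.val := by simpa using congrArg Fin.val hc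
        refine h j.castSucc j.succ c.succ (by simp) (by simp [hv]) ⟨hj' _ ?_, hj' _ ?_⟩
        · intro h; simpa using congrArg Fin.val h
        · intro h; have := congrArg Fin.val h; simp at this; omega
      · right
        rw [← hc]
        refine ⟨hj, fun a b c hab hbc => ?_⟩
        simp only [hc, Fin.succAbove_last]
        exact h _ _ _ (by simpa using hab) (by simpa using hbc)
  · rintro (⟨h1, h2⟩ | ⟨h1, h2⟩) a b c hab hbc ⟨h3, h4⟩
    · rcases Fin.eq_zero_or_eq_succ a with rfl | ⟨a, rfl⟩
      · have hb : b ≠ 0 := by rintro rfl; simp at hab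
        obtain ⟨b, rfl⟩ := Fin.exists_succ_eq.2 hb
        exact lt_asymm h3 (h1 b)
      · obtain ⟨b, rfl⟩ := Fin.exists_succ_eq.2 (show b ≠ 0 by rintro rfl; simp at hab)
        obtain ⟨c, rfl⟩ := Fin.exists_succ_eq.2 (show c ≠ 0 by rintro rfl; simp at hbc)
        exact h2 a b c (by simpa using hab) (by simpa using hbc) ⟨h3, h4⟩
    · simp only [Fin.succAbove_last] at h1 h2
      have hc1 := c.isLt
      obtain ⟨a, rfl⟩ : ∃ a', a = Fin.castSucc a' :=
        ⟨⟨a, by omega⟩, rfl⟩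
      obtain ⟨b, rfl⟩ : ∃ a', b = Fin.castSucc a' :=
        ⟨⟨b, by omega⟩, rfl⟩
      rcases Fin.eq_castSucc_or_eq_last c with ⟨c, rfl⟩ | rfl
      · exact h2 a b c (by simpa using hab) (by simpa using hbc) ⟨h3, h4⟩
      · exact lt_asymm h4 (h1 b)

/-- The measure of the sequences without interior strict local maxima, for a product of copies of
an atomless measure. -/
theorem pi_noPeak (m : ℕ) (ν : Measure ℝ≥0) [IsFiniteMeasure ν] [NullSingletonClass ν] :
    Measure.pi (fun _ : Fin (m + 1) => ν) {y | NoPeak y} =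
      2 ^ m / ((m + 1).factorial : ENNReal) * ν Set.univ ^ (m + 1) := by
  induction m generalizing ν with
  | zero =>
    have : {y : Fin (0 + 1) → ℝ≥0 | NoPeak y} = Set.univ := by
      ext y
      simp only [Set.mem_ofPred_eq, Set.mem_univ, iff_true]
      intro a b c hab
      omega
    rw [this, Measure.pi_univ]
    simp
  | succ m ih =>
    have h1 : ∀ j : Fin (m + 2), Measure.pi (fun _ : Fin (m + 2) => ν) (maxAt j {z | NoPeak z}) =
        2 ^ m / ((m + 1).factorial : ENNReal) * ∫⁻ x, ν (Set.Iio x) ^ (m + 1) ∂ν := by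
      intro j
      rw [pi_maxAt j (measurableSet_noPeak _)]
      simp_rw [ih]
      rw [lintegral_const_mul']
      · simp
      · exact ENNReal.div_ne_top (by simp) (by simp [Nat.factorial_ne_zero])
    have h2 : Measure.pi (fun _ : Fin (m + 2) => ν) {y | NoPeak y} =
        Measure.pi (fun _ : Fin (m + 2) => ν)
          (maxAt 0 {z | NoPeak z} ∪ maxAt (Fin.last (m + 1)) {z | NoPeak z}) := by
      refine measure_congr ?_
      filter_upwards [ae_injective (m + 2) ν] with y hy
      exact propext (noPeak_iff hy)
    -- The two end positions contribute equally. Writing `ν univ ^ (m + 2)` as `m + 2` times the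
    -- same integral makes the integral cancel, leaving the factor `2 / (m + 2)`.
    rw [h2, measure_union (maxAt_disjoint (by simp [Fin.ext_iff]))
      (measurableSet_maxAt _ (measurableSet_noPeak _)), h1, h1,
      ← lintegral_Iio_pow (m + 1) ν, Nat.factorial_succ (m + 1)]
    have hf : ((m + 1 + 1 : ℕ) : ENNReal) ≠ 0 := by simp
    have hf' : ((m + 1 + 1 : ℕ) : ENNReal) ≠ ⊤ := by simp
    rw [← two_mul, ← mul_assoc, ← mul_assoc]
    congr 1
    rw [Nat.cast_mul, ENNReal.div_eq_inv_mul, ENNReal.div_eq_inv_mul,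
      ENNReal.mul_inv (Or.inl hf) (Or.inl hf'), pow_succ]
    calc _ = (((m + 1 + 1 : ℕ) : ENNReal)⁻¹ * ((m + 1 + 1 : ℕ) : ENNReal)) * (2 *
          (((m + 1).factorial : ENNReal)⁻¹ * 2 ^ m)) := by
          rw [ENNReal.inv_mul_cancel hf hf', one_mul]
      _ = _ := by ring

end Peaks

end MeteorProcess

/-! ### Law of the last hit of a Poisson process -/

namespace MeteorProcess

theorem measurable_lastHit (t : ℝ≥0) : Measurable fun f : ℝ≥0 → ℕ => lastHit f t := by
  unfold lastHit
  refine Measurable.iInf fun i => Measurable.ite ?_ measurable_const measurable_const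
  exact measurableSet_eq_fun (measurable_pi_apply _) (measurable_pi_apply _)

section Poisson

variable {Ω : Type*} [MeasurableSpace Ω] {P : Measure Ω} {N : ℝ≥0 → Ω → ℕ}

theorem IsPoissonProcess.ae_isCountingPath {r : ℝ≥0} (h : IsPoissonProcess r N P) :
    ∀ᵐ ω ∂P, IsCountingPath fun t => N t ω := by
  filter_upwards [h.mono, h.rightCont] with ω h1 h2 using ⟨h1, h2⟩

theorem IsPoissonProcess.measure_eq (h : IsPoissonProcess 1 N P) {s t : ℝ≥0} (hst : s ≤ t) :
    P {ω | N s ω = N t ω} = ENNReal.ofReal (Real.exp (-(t - s : ℝ))) := by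
  have h1 := (h.law s t hst).measure_eq (p := fun x => x = 0) (measurableSet_singleton _)
  have h2 : P {ω | N s ω = N t ω} = P {ω | N t ω - N s ω = 0} := by
    refine measure_congr ?_
    filter_upwards [h.mono] with ω hω
    have := hω hst
    refine propext ?_
    change N s ω = N t ω ↔ N t ω - N s ω = 0
    dsimp only at this
    omega
  have h3 : {x : ℕ | x = 0} = {0} := rfl
  rw [h2, h1, h3, poissonMeasure_singleton]
  simp [NNReal.coe_sub hst]

theorem IsPoissonProcess.measurable_path {r : ℝ≥0} (h : IsPoissonProcess r N P) :
    Measurable fun ω t => N t ω :=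
  measurable_pi_lambda _ h.measurable

theorem IsPoissonProcess.measurable_lastHit {r : ℝ≥0} (h : IsPoissonProcess r N P) (t : ℝ≥0) :
    Measurable fun ω => lastHit (fun s => N s ω) t :=
  (MeteorProcess.measurable_lastHit t).comp h.measurable_path

theorem IsPoissonProcess.map_lastHit_Iic (h : IsPoissonProcess 1 N P) {s t : ℝ≥0} (hst : s ≤ t) :
    P.map (fun ω => lastHit (fun s => N s ω) t) (Set.Iic s) =
      ENNReal.ofReal (Real.exp (-(t - s : ℝ))) := by
  rw [Measure.map_apply (h.measurable_lastHit t) measurableSet_Iic, ← h.measure_eq hst]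
  refine measure_congr ?_
  filter_upwards [h.ae_isCountingPath] with ω hω
  exact propext (hω.lastHit_le_iff hst)

variable [IsProbabilityMeasure P]

theorem IsPoissonProcess.map_lastHit_eq {N' : ℝ≥0 → Ω → ℕ} (h : IsPoissonProcess 1 N P)
    (h' : IsPoissonProcess 1 N' P) (t : ℝ≥0) :
    P.map (fun ω => lastHit (fun s => N s ω) t) = P.map (fun ω => lastHit (fun s => N' s ω) t) := by
  have := Measure.isProbabilityMeasure_map (μ := P) (h.measurable_lastHit t).aemeasurable
  refine Measure.ext_of_Iic _ _ fun s => ?_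
  rcases le_total s t with hst | hst
  · rw [h.map_lastHit_Iic hst, h'.map_lastHit_Iic hst]
  · rw [Measure.map_apply (h.measurable_lastHit t) measurableSet_Iic,
      Measure.map_apply (h'.measurable_lastHit t) measurableSet_Iic]
    congr 1
    ext ω
    simp [(lastHit_le_self _ t).trans hst]

theorem IsPoissonProcess.map_lastHit_Ioi (h : IsPoissonProcess 1 N P) (t : ℝ≥0) :
    P.map (fun ω => lastHit (fun s => N s ω) t) (Set.Ioi 0) =
      ENNReal.ofReal (1 - Real.exp (-t)) := by
  have := Measure.isProbabilityMeasure_map (μ := P) (h.measurable_lastHit t).aemeasurable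
  rw [← Set.compl_Iic, prob_compl_eq_one_sub measurableSet_Iic, h.map_lastHit_Iic (zero_le),
    ENNReal.ofReal_sub _ (Real.exp_pos _).le]
  simp

/-- The law has an atom at `0`, hence the restriction. For `0 < x ≤ t`, a last hit at `x` forces a
jump in `(s, x]` for each `s < x`, an event of probability `1 - exp (-(x - s))`, which tends to `0`
as `s` increases to `x`. -/
theorem IsPoissonProcess.nullSingletonClass_restrict (h : IsPoissonProcess 1 N P) (t : ℝ≥0) :
    NullSingletonClass
      ((P.map (fun ω => lastHit (fun s => N s ω) t)).restrict (Set.Ioi 0)) := by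
  refine ⟨fun x => ?_⟩
  rw [Measure.restrict_apply (measurableSet_singleton x)]
  rcases eq_zero_or_pos x with rfl | hx
  · simp
  refine measure_mono_null Set.inter_subset_left ?_
  rw [Measure.map_apply (h.measurable_lastHit t) (measurableSet_singleton x)]
  rcases lt_or_ge t x with htx | hxt
  · rw [← measure_empty (μ := P)]
    congr 1
    ext ω
    simpa using ((lastHit_le_self _ t).trans_lt htx).ne
  have hne : (𝓝[<] x).NeBot := nhdsLT_neBot_of_exists_lt ⟨0, hx⟩
  have hb : ∀ s < x, P ((fun ω => lastHit (fun s => N s ω) t) ⁻¹' {x}) ≤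
      1 - ENNReal.ofReal (Real.exp (-(x - s : ℝ))) := by
    intro s hs
    have hm : MeasurableSet {ω | N s ω = N x ω} :=
      measurableSet_eq_fun (h.measurable s) (h.measurable x)
    rw [← h.measure_eq hs.le, ← prob_compl_eq_one_sub hm]
    refine measure_mono_ae ?_
    filter_upwards [h.ae_isCountingPath] with ω hω hωx hc
    have hωx : lastHit (fun s => N s ω) t = x := hωx
    have hc : N s ω = N x ω := hc
    have h1 := (hω.lastHit_le_iff hxt).1 hωx.le
    have h2 := (hω.lastHit_le_iff (hs.le.trans hxt)).2 (hc.trans h1)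
    rw [hωx] at h2
    exact absurd h2 (not_le.2 hs)
  refine le_antisymm (ge_of_tendsto (x := 𝓝[<] x) (f := fun s : ℝ≥0 =>
    1 - ENNReal.ofReal (Real.exp (-(x - s : ℝ)))) ?_
    (eventually_nhdsWithin_of_forall hb)) zero_le
  have hcont : Continuous fun s : ℝ≥0 => 1 - ENNReal.ofReal (Real.exp (-(x - s : ℝ))) := by
    refine (ENNReal.continuous_sub_left ENNReal.one_ne_top).comp
      (ENNReal.continuous_ofReal.comp ?_)
    fun_prop
  have := (hcont.tendsto x).mono_left (nhdsWithin_le_nhds (s := Set.Iio x))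
  simpa using this

end Poisson

/-! ### Absence of adjacent craters under stationarity -/

section Connected

variable {V : Type*} [Fintype V] [DecidableEq V] {G : SimpleGraph V} [DecidableRel G.Adj]
  {n : V → ℝ≥0 → ℕ} {m : ℝ≥0 → V → ℝ≥0}

/-- Live edges spread along a walk when every vertex is hit in each of as many rounds. -/
theorem Evolves.live_of_walk (hm : Evolves G n m) (hn : ∀ v, IsCountingPath (n v)) (R : ℝ≥0)
    {x y : V} (w : G.Walk x y) (s : ℝ≥0) (hx : ∀ z, G.Adj x z → Live (m s) x z)
    (hr : ∀ i < w.length, ∀ v, n v (s + i * R) ≠ n v (s + (i + 1) * R)) :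
    ∀ z, G.Adj y z → Live (m (s + w.length * R)) y z := by
  induction w generalizing s with
  | nil => simpa using hx
  | @cons u v w h p ih =>
    have h0 : n u s ≠ n u (s + R) := by simpa using hr 0 (by simp) u
    have := ih (s + R) (fun z hz => hm.live_spread hn h hz le_self_add (hx v h) h0) ?_
    · intro z hz
      have := this z hz
      convert this using 2
      simp only [SimpleGraph.Walk.length_cons, Nat.cast_add, Nat.cast_one]
      ring
    · intro i hi v
      have := hr (i + 1) (by simpa using hi) v
      convert this using 2
      · push_cast; ring
      · push_cast; ring

theorem Evolves.live_of_connected (hG : G.Connected) (hm : Evolves G n m)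
    (hn : ∀ v, IsCountingPath (n v)) (R : ℝ≥0) {x : V} (hx : m 0 x ≠ 0)
    (hr : ∀ i < Fintype.card V, ∀ v, n v (i * R) ≠ n v ((i + 1) * R)) {y z : V}
    (hyz : G.Adj y z) : Live (m (Fintype.card V * R)) y z := by
  obtain ⟨w, hw⟩ := (hG.preconnected x y).exists_isPath
  have hlen := hw.length_lt
  have := hm.live_of_walk hn R w 0 (fun z _ => Or.inl hx)
    (fun i hi v => by simpa using hr i (hi.trans hlen) v) z hyz
  rw [zero_add] at this
  -- The path has fewer than `Fintype.card V` edges; persistence of liveness covers the remaining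
  -- rounds.
  refine hm.live_mono hn hyz ?_ this
  gcongr

variable {Ω : Type*} [MeasurableSpace Ω] {P : Measure Ω}
  {N : V → ℝ≥0 → Ω → ℕ} {M : ℝ≥0 → Ω → V → ℝ≥0} {Q : Measure (V → ℝ≥0)}

theorem IsMeteorProcess.ae_isCountingPath (hM : IsMeteorProcess G N M P) :
    ∀ᵐ ω ∂P, ∀ v, IsCountingPath fun t => N v t ω :=
  ae_all_iff.2 fun v => (hM.poisson v).ae_isCountingPath

/-- In the stationary regime, no two neighbors are craters. -/
theorem IsMeteorProcess.ae_live (hG : G.Connected) (hM : IsMeteorProcess G N M P)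
    (hmass : ∀ᵐ ω ∂P, ∃ x, M 0 ω x ≠ 0) (hQ : ∀ t, HasLaw (M t) Q P) {y z : V}
    (hyz : G.Adj y z) : ∀ᵐ ω ∂P, Live (M 0 ω) y z := by
  have hms : MeasurableSet {m : V → ℝ≥0 | ¬ Live m y z} := by
    refine MeasurableSet.compl (MeasurableSet.union ?_ ?_)
    · exact ((measurableSet_singleton 0).preimage (measurable_pi_apply y)).compl
    · exact ((measurableSet_singleton 0).preimage (measurable_pi_apply z)).compl
  rw [ae_iff]
  set K := Fintype.card V
  -- By stationarity the probability is the same at time `K * R`, where failure requires that some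
  -- vertex be missed in one of `K` rounds of length `R`. The union bound vanishes as `R → ∞`.
  have hb : ∀ R : ℝ≥0, P {ω | ¬ Live (M 0 ω) y z} ≤
      (K * K : ℕ) * ENNReal.ofReal (Real.exp (-R)) := by
    intro R
    rw [(hQ 0).measure_eq hms, ← (hQ (K * R)).measure_eq hms]
    calc P {ω | ¬ Live (M (K * R) ω) y z}
        ≤ P (⋃ i : Fin K, ⋃ v : V, {ω | N v (i * R) ω = N v ((i + 1) * R) ω}) := by
          refine measure_mono_ae ?_
          filter_upwards [hM.ae_isCountingPath, hmass, hM.evolves] with ω h1 h2 h3 h4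
          obtain ⟨x, hx⟩ := h2
          by_contra hc
          refine h4 (h3.live_of_connected hG h1 R hx (fun i hi v heq => hc ?_) hyz)
          exact Set.mem_iUnion.2 ⟨⟨i, hi⟩, Set.mem_iUnion.2 ⟨v, heq⟩⟩
      _ ≤ ∑ i : Fin K, ∑ v : V, P {ω | N v (i * R) ω = N v ((i + 1) * R) ω} :=
          (measure_iUnion_fintype_le _ _).trans
            (Finset.sum_le_sum fun i _ => measure_iUnion_fintype_le _ _)
      _ = ∑ i : Fin K, ∑ v : V, ENNReal.ofReal (Real.exp (-R)) := by
          refine Finset.sum_congr rfl fun i _ => Finset.sum_congr rfl fun v _ => ?_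
          rw [(hM.poisson v).measure_eq (by gcongr; simp)]
          congr 3
          push_cast
          ring
      _ = _ := by
          simp [K, mul_assoc]
  refine le_antisymm (ge_of_tendsto (x := (atTop : Filter ℝ≥0)) ?_ (Eventually.of_forall hb))
    zero_le
  have h1 : Tendsto (fun R : ℝ≥0 => Real.exp (-R)) atTop (𝓝 0) :=
    Real.tendsto_exp_neg_atTop_nhds_zero.comp (NNReal.tendsto_coe_atTop.2 tendsto_id)
  have h2 := ENNReal.Tendsto.const_mul (a := ((K * K : ℕ) : ENNReal))
    (ENNReal.tendsto_ofReal h1) (Or.inr (ENNReal.natCast_ne_top _))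
  simpa using h2

end Connected

end MeteorProcess

/-! ### Windows of non-craters on the cycle -/

namespace MeteorProcess

theorem measurableSet_isCrater {V : Type*} (v : V) :
    MeasurableSet {m : V → ℝ≥0 | IsCrater m v} :=
  (measurableSet_singleton 0).preimage (measurable_pi_apply v)

section Cycle

variable {k : ℕ} [NeZero k]

theorem site_val (j : ℕ) : (site k j).val = j % k := rfl

theorem site_add_period (j : ℕ) : site k (j + k) = site k j := by
  ext; simp [site_val]

theorem site_succ (hk : 2 ≤ k) (j : ℕ) : (site k (j + 1) - site k j).val = 1 := by
  obtain ⟨k, rfl⟩ := Nat.exists_eq_add_of_le' hk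
  have : site (k + 2) (j + 1) = site (k + 2) j + 1 := by
    ext; simp [site_val, Fin.val_add]
  rw [this]
  simp

theorem adj_site_succ (hk : 2 ≤ k) (j : ℕ) :
    (SimpleGraph.cycleGraph k).Adj (site k j) (site k (j + 1)) :=
  SimpleGraph.cycleGraph_adj'.2 (Or.inr (site_succ hk j))

theorem eq_site_of_adj (hk : 2 ≤ k) {j : ℕ} {y : Fin k}
    (h : (SimpleGraph.cycleGraph k).Adj (site k (j + 1)) y) :
    y = site k j ∨ y = site k (j + 2) := by
  rw [SimpleGraph.cycleGraph_adj'] at h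
  rcases h with h | h
  · left
    exact (sub_right_injective (Fin.ext (h.trans (site_succ hk j).symm)))
  · right
    exact sub_left_injective (Fin.ext (h.trans (site_succ hk (j + 1)).symm))

theorem site_add_injective {m : ℕ} (hm : m ≤ k) (a : ℕ) :
    Function.Injective fun i : Fin m => site k (a + i) := by
  intro i j hij
  have h : (a + i) % k = (a + j) % k := congrArg Fin.val hij
  have h' : (i : ℕ) % k = j % k := Nat.ModEq.add_left_cancel' a h
  rw [Nat.mod_eq_of_lt (i.isLt.trans_le hm), Nat.mod_eq_of_lt (j.isLt.trans_le hm)] at h'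
  exact Fin.ext h'

theorem measurableSet_nonCraters (a n : ℕ) :
    MeasurableSet {m : Fin k → ℝ≥0 | NonCraters m a n} := by
  refine (MeasurableSet.iInter fun i => MeasurableSet.iInter fun _ : a + 1 ≤ i =>
    MeasurableSet.iInter fun _ : i ≤ a + n => (measurableSet_isCrater (site k i)).compl).congr ?_
  ext m
  simp [NonCraters]

theorem nonCraters_succ (m : Fin k → ℝ≥0) (a n : ℕ) :
    NonCraters m a (n + 1) ↔ NonCraters m a n ∧ ¬ IsCrater m (site k (a + n + 1)) := by
  constructor
  · exact fun h => ⟨fun i h1 h2 => h i h1 (by omega), h _ (by omega) (by omega)⟩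
  · rintro ⟨h, h'⟩ i h1 h2
    rcases h2.eq_or_lt with rfl | h2
    · exact h'
    · exact h i h1 (by omega)

theorem nonCraters_succ' (m : Fin k → ℝ≥0) (a n : ℕ) :
    NonCraters m a (n + 1) ↔ ¬ IsCrater m (site k (a + 1)) ∧ NonCraters m (a + 1) n := by
  constructor
  · exact fun h => ⟨h _ (by omega) (by omega), fun i h1 h2 => h i (by omega) (by omega)⟩
  · rintro ⟨h', h⟩ i h1 h2
    rcases h1.eq_or_lt with rfl | h1
    · exact h'
    · exact h i (by omega) (by omega)

theorem nonCraters_zero (m : Fin k → ℝ≥0) (a : ℕ) : NonCraters m a 0 :=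
  fun i h1 h2 => absurd h1 (by omega)

theorem nonCraters_add_period (m : Fin k → ℝ≥0) (a n : ℕ) :
    NonCraters m (a + k) n ↔ NonCraters m a n := by
  induction n with
  | zero => simp [nonCraters_zero]
  | succ n ih =>
    rw [nonCraters_succ, nonCraters_succ, ih,
      show a + k + n + 1 = a + n + 1 + k by omega, site_add_period]

/-- The window `a + 1, …, a + n` contains no crater if and only if the last hits of
`a, …, a + n + 1` have no interior local maximum. -/
theorem Evolves.nonCraters_iff (hk : 2 ≤ k) {p : Fin k → ℝ≥0 → ℕ} {m : ℝ≥0 → Fin k → ℝ≥0}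
    (hm : Evolves (SimpleGraph.cycleGraph k) p m) (hp : ∀ v, IsCountingPath (p v))
    (hlive : ∀ x y, (SimpleGraph.cycleGraph k).Adj x y → Live (m 0) x y) (t : ℝ≥0) (a n : ℕ)
    (hinj : Function.Injective fun i : Fin (n + 2) => lastHit (p (site k (a + i))) t) :
    NonCraters (m t) a n ↔ NoPeak fun i : Fin (n + 2) => lastHit (p (site k (a + i))) t := by
  constructor
  · intro h i j l hij hjl ⟨h1, h2⟩
    refine h (a + j) (by omega) (by omega) ?_
    have hj : a + j.val = a + i + 1 := by omega
    have hl : a + l.val = a + i + 2 := by omega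
    refine hm.eq_zero_of_lastHit hp (w := site k (a + i)) ?_ t ?_
    · rw [hj]; exact (adj_site_succ hk _).symm
    · intro y hy
      rw [hj] at hy
      rcases eq_site_of_adj hk hy with rfl | rfl
      · exact h1
      · rw [← hl]; exact h2
  · intro h i h1 h2
    obtain ⟨d, rfl⟩ := Nat.exists_eq_add_of_le h1
    have h3 := h ⟨d, by omega⟩ ⟨d + 1, by omega⟩ ⟨d + 2, by omega⟩ rfl rfl
    have e1 : a + 1 + d = a + d + 1 := by omega
    have e2 : a + 1 + d = a + (d + 1) := by omega
    rcases not_and_or.1 h3 with h3 | h3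
    -- Injectivity excludes ties, so failing to be a strict peak yields a neighbor hit strictly
    -- later.
    · have h4 := lt_of_le_of_ne (not_lt.1 h3) (hinj.ne (by simp))
      have hadj : (SimpleGraph.cycleGraph k).Adj (site k (a + 1 + d)) (site k (a + d)) := by
        rw [e1]; exact (adj_site_succ hk _).symm
      refine hm.ne_zero_of_lastHit hp hadj (hlive _ _ hadj) t ?_
      rw [e2]; exact h4
    · have h4 := lt_of_le_of_ne (not_lt.1 h3) (hinj.ne (by simp))
      have hadj : (SimpleGraph.cycleGraph k).Adj (site k (a + 1 + d)) (site k (a + (d + 2))) := by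
        rw [e1]; exact adj_site_succ hk _
      refine hm.ne_zero_of_lastHit hp hadj (hlive _ _ hadj) t ?_
      rw [e2]; exact h4

variable {Ω : Type*} [MeasurableSpace Ω] {P : Measure Ω} [IsProbabilityMeasure P]
  {N : Fin k → ℝ≥0 → Ω → ℕ} {M : ℝ≥0 → Ω → Fin k → ℝ≥0} {Q : Measure (Fin k → ℝ≥0)}

/-- On the event that all `n + 2` sites have been hit by time `t`, of probability `(1 - exp (-t)) ^
(n + 2)`, the window is crater-free iff the last hits have no peak. The complement is only bounded,
which is the extra term on the right. -/
theorem IsMeteorProcess.measureReal_nonCraters_bounds (hk : 2 ≤ k)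
    (hM : IsMeteorProcess (SimpleGraph.cycleGraph k) N M P)
    (hlive : ∀ᵐ ω ∂P, ∀ x y, (SimpleGraph.cycleGraph k).Adj x y → Live (M 0 ω) x y)
    {n : ℕ} (hn : n + 2 ≤ k) (a : ℕ) (t : ℝ≥0) :
    2 ^ (n + 1) / ((n + 2).factorial : ℝ) * (1 - Real.exp (-t)) ^ (n + 2) ≤
        P.real {ω | NonCraters (M t ω) a n} ∧
      P.real {ω | NonCraters (M t ω) a n} ≤
        2 ^ (n + 1) / ((n + 2).factorial : ℝ) * (1 - Real.exp (-t)) ^ (n + 2) +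
          (1 - (1 - Real.exp (-t)) ^ (n + 2)) := by
  set X : Fin k → Ω → ℝ≥0 := fun v ω => lastHit (fun s => N v s ω) t with hX
  set ν : Measure ℝ≥0 := P.map (X 0) with hν
  have hXm : ∀ v, Measurable (X v) := fun v => (hM.poisson v).measurable_lastHit t
  have hνp : IsProbabilityMeasure ν := Measure.isProbabilityMeasure_map (hXm 0).aemeasurable
  have hlaw : ∀ v, HasLaw (X v) ν P := fun v =>
    ⟨(hXm v).aemeasurable, (hM.poisson v).map_lastHit_eq (hM.poisson 0) t⟩
  have hind : iIndepFun X P := hM.indep.comp (fun _ f => lastHit f t) fun _ => measurable_lastHit t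
  set Y : Ω → Fin (n + 2) → ℝ≥0 := fun ω i => X (site k (a + i)) ω with hY
  -- Since `n + 2 ≤ k`, the sites are distinct and their last hits independent.
  have hYlaw : HasLaw Y (Measure.pi fun _ => ν) P :=
    iIndepFun.hasLaw_pi (fun i : Fin (n + 2) => hlaw (site k (a + i)))
      (hind.precomp (site_add_injective hn a))
  set S : Set (Fin (n + 2) → ℝ≥0) := Set.univ.pi fun _ => Set.Ioi 0 with hS
  have hSm : MeasurableSet S := MeasurableSet.univ_pi fun _ => measurableSet_Ioi
  have hν0 : NullSingletonClass (ν.restrict (Set.Ioi 0)) :=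
    (hM.poisson 0).nullSingletonClass_restrict t
  have hνu : ν.restrict (Set.Ioi 0) Set.univ = ENNReal.ofReal (1 - Real.exp (-t)) := by
    rw [Measure.restrict_apply_univ]
    exact (hM.poisson 0).map_lastHit_Ioi t
  have hc0 : 0 ≤ 1 - Real.exp (-(t : ℝ)) := by simp
  have hprob : ∀ A : Set (Fin (n + 2) → ℝ≥0), MeasurableSet A →
      P {ω | Y ω ∈ A ∩ S} = Measure.pi (fun _ => ν.restrict (Set.Ioi 0)) A := by
    intro A hA
    rw [← Measure.restrict_pi_pi, Measure.restrict_apply hA]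
    exact hYlaw.measure_eq (hA.inter hSm)
  have hpeak : P.real {ω | Y ω ∈ {y | NoPeak y} ∩ S} =
      2 ^ (n + 1) / ((n + 2).factorial : ℝ) * (1 - Real.exp (-t)) ^ (n + 2) := by
    rw [measureReal_def, hprob _ (measurableSet_noPeak _), pi_noPeak, hνu]
    simp [ENNReal.toReal_ofReal hc0]
  have hpos : P.real {ω | Y ω ∈ S} = (1 - Real.exp (-t)) ^ (n + 2) := by
    have := hprob Set.univ .univ
    rw [Set.univ_inter, Measure.pi_univ] at this
    rw [measureReal_def, this]
    simp only [hνu]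
    simp [ENNReal.toReal_ofReal hc0]
  have hinj : ∀ᵐ ω ∂P, Y ω ∈ S → Function.Injective (Y ω) := by
    have : ∀ i j : Fin (n + 2), i ≠ j → ∀ᵐ ω ∂P, ¬ Y ω ∈ {y | y i = y j} ∩ S := by
      intro i j hij
      rw [ae_iff]
      simp only [not_not]
      rw [hprob _ (measurableSet_eq_fun (measurable_pi_apply i) (measurable_pi_apply j))]
      exact pi_eq_coord hij _
    simp only [← ae_all_iff] at this
    filter_upwards [this] with ω h hS i j hij
    by_contra hne
    exact h i j hne ⟨hij, hS⟩
  have hiff : ∀ᵐ ω ∂P, Y ω ∈ S → (NonCraters (M t ω) a n ↔ NoPeak (Y ω)) := by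
    filter_upwards [hinj, hM.evolves, hM.ae_isCountingPath, hlive] with ω h1 h2 h3 h4 h5
    exact h2.nonCraters_iff hk h3 h4 t a n (h1 h5)
  have hSm' : NullMeasurableSet {ω | Y ω ∈ S} P := hYlaw.aemeasurable.nullMeasurable hSm
  constructor
  · rw [← hpeak]
    refine ENNReal.toReal_mono (measure_ne_top _ _) (measure_mono_ae ?_)
    filter_upwards [hiff] with ω h h'
    exact (h h'.2).2 h'.1
  · rw [← hpeak, ← hpos, ← probReal_compl_eq_one_sub₀ hSm']
    refine le_trans ?_ (measureReal_union_le _ _)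
    refine ENNReal.toReal_mono (measure_ne_top _ _) (measure_mono_ae ?_)
    filter_upwards [hiff] with ω h h'
    by_cases hω : Y ω ∈ S
    · exact Or.inl ⟨(h hω).1 h', hω⟩
    · exact Or.inr hω

/-- Stationarity makes the probability independent of `t`, so both bounds can be taken to the limit
`t → ∞`. -/
theorem IsMeteorProcess.measureReal_nonCraters (hk : 2 ≤ k)
    (hM : IsMeteorProcess (SimpleGraph.cycleGraph k) N M P)
    (hmass : ∀ᵐ ω ∂P, ∑ v, M 0 ω v = k) (hQ : ∀ t, HasLaw (M t) Q P)
    {n : ℕ} (hn : n + 2 ≤ k) (a : ℕ) :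
    P.real {ω | NonCraters (M 0 ω) a n} = 2 ^ (n + 1) / ((n + 2).factorial : ℝ) := by
  have hG : (SimpleGraph.cycleGraph k).Connected := by
    obtain ⟨k, rfl⟩ := Nat.exists_eq_add_of_le' hk
    exact SimpleGraph.cycleGraph_connected
  have hpos : ∀ᵐ ω ∂P, ∃ x, M 0 ω x ≠ 0 := by
    filter_upwards [hmass] with ω hω
    by_contra! hc
    simp only [hc, Finset.sum_const_zero] at hω
    exact NeZero.ne k (by exact_mod_cast hω.symm)
  have hlive : ∀ᵐ ω ∂P, ∀ x y, (SimpleGraph.cycleGraph k).Adj x y → Live (M 0 ω) x y := by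
    simp only [ae_all_iff]
    exact fun x y hxy => hM.ae_live hG hpos hQ hxy
  have hb := fun t => hM.measureReal_nonCraters_bounds hk hlive hn a t
  have hst : ∀ t, P.real {ω | NonCraters (M t ω) a n} = P.real {ω | NonCraters (M 0 ω) a n} :=
    fun t => ((hQ t).measureReal_eq (measurableSet_nonCraters a n)).trans
      ((hQ 0).measureReal_eq (measurableSet_nonCraters a n)).symm
  simp only [hst] at hb
  have h1 : Tendsto (fun t : ℝ≥0 => (1 - Real.exp (-t)) ^ (n + 2)) atTop (𝓝 1) := by
    have : Tendsto (fun t : ℝ≥0 => Real.exp (-t)) atTop (𝓝 0) :=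
      Real.tendsto_exp_neg_atTop_nhds_zero.comp (NNReal.tendsto_coe_atTop.2 tendsto_id)
    simpa using (this.const_sub 1).pow (n + 2)
  have h2 := h1.const_mul (2 ^ (n + 1) / ((n + 2).factorial : ℝ))
  refine le_antisymm ?_ ?_
  · have := h2.add (h1.const_sub 1)
    simp only [mul_one, sub_self, add_zero] at this
    exact ge_of_tendsto' this fun t => (hb t).2
  · rw [mul_one] at h2
    exact le_of_tendsto' h2 fun t => (hb t).1

end Cycle

end MeteorProcess

/-! ### The three formulas -/

theorem theorem4p1 (k : ℕ) [NeZero k]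
    {Ω : Type*} [MeasurableSpace Ω] (P : Measure Ω) [IsProbabilityMeasure P]
    (N : Fin k → ℝ≥0 → Ω → ℕ) (M : ℝ≥0 → Ω → Fin k → ℝ≥0)
    (hM : MeteorProcess.IsMeteorProcess (SimpleGraph.cycleGraph k) N M P)
    (hmass : ∀ᵐ ω ∂P, ∑ v, M 0 ω v = k)
    (Q : Measure (Fin k → ℝ≥0)) (hQ : ∀ t, HasLaw (M t) Q P) :
    (3 ≤ k → ∀ a : ℕ,
      P.real {ω | MeteorProcess.IsCrater (M 0 ω) (MeteorProcess.site k a)} = 1 / 3) ∧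
    (∀ n : ℕ, 1 ≤ n → n + 4 ≤ k → ∀ a : ℕ,
      P.real {ω | MeteorProcess.MaximalNonCraters (M 0 ω) a n} =
        (n : ℝ) * ((n : ℝ) + 3) * 2 ^ (n + 1) / (Nat.factorial (n + 4) : ℝ)) ∧
    (∀ n : ℕ, 1 ≤ n → n + 3 ≤ k → ∀ a : ℕ,
      P.real {ω | MeteorProcess.NonCraters (M 0 ω) a n} =
        2 ^ (n + 1) / (Nat.factorial (n + 2) : ℝ)) := by
  -- Labels are natural numbers, so the predecessor of `a` is represented by `a + k - 1`, which also
  -- covers `a = 0`.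
  have hsucc : ∀ a : ℕ, ∃ b, MeteorProcess.site k (b + 1) = MeteorProcess.site k a ∧
      ∀ (m : Fin k → ℝ≥0) (n : ℕ),
        MeteorProcess.NonCraters m (b + 1) n ↔ MeteorProcess.NonCraters m a n := by
    intro a
    have hk := Nat.pos_of_ne_zero (NeZero.ne k)
    have e : a + k - 1 + 1 = a + k := by omega
    refine ⟨a + k - 1, ?_, fun m n => ?_⟩
    · rw [e, MeteorProcess.site_add_period]
    · rw [e, MeteorProcess.nonCraters_add_period]
  have hmeas : ∀ a n : ℕ, NullMeasurableSet {ω | MeteorProcess.NonCraters (M 0 ω) a n} P :=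
    fun a n => (hQ 0).aemeasurable.nullMeasurable (MeteorProcess.measurableSet_nonCraters a n)
  refine ⟨fun hk a => ?_, fun n _ hk a => ?_, fun n _ hk a =>
    hM.measureReal_nonCraters (by omega) hmass hQ (by omega) a⟩
  · obtain ⟨b, hb, -⟩ := hsucc a
    have hset : {ω | MeteorProcess.IsCrater (M 0 ω) (MeteorProcess.site k a)} =
        {ω | MeteorProcess.NonCraters (M 0 ω) b 1}ᶜ := by
      ext ω
      simp [MeteorProcess.nonCraters_succ', MeteorProcess.nonCraters_zero, hb]
    rw [hset, probReal_compl_eq_one_sub₀ (hmeas b 1),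
      hM.measureReal_nonCraters (by omega) hmass hQ (by omega) b]
    norm_num [Nat.factorial]
  · obtain ⟨b, hb, hb'⟩ := hsucc a
    set A := {ω | MeteorProcess.NonCraters (M 0 ω) a n} with hA
    set B := {ω | MeteorProcess.NonCraters (M 0 ω) a (n + 1)} with hB
    set C := {ω | MeteorProcess.NonCraters (M 0 ω) b (n + 1)} with hC
    have hBA : B ⊆ A := fun ω h => ((MeteorProcess.nonCraters_succ _ _ _).1 h).1
    have hCA : C ⊆ A := fun ω h =>
      (hb' _ _).1 ((MeteorProcess.nonCraters_succ' _ _ _).1 h).2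
    have hBC : B ∩ C = {ω | MeteorProcess.NonCraters (M 0 ω) b (n + 2)} := by
      ext ω
      simp only [hB, hC, Set.mem_inter_iff, Set.mem_ofPred_eq,
        MeteorProcess.nonCraters_succ' _ b, hb, hb', MeteorProcess.nonCraters_succ _ a]
      tauto
    -- `B` and `C` extend the window by one non-crater to the right and to the left; maximality
    -- excludes both. With `p j` the probability of a crater-free window of length `j`, the result
    -- is `p n - 2 * p (n + 1) + p (n + 2)`. The last term involves `n + 4` sites, hence `n + 4 ≤
    -- k`.
    have hmax : {ω | MeteorProcess.MaximalNonCraters (M 0 ω) a n} = A \ (B ∪ C) := by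
      ext ω
      simp only [hA, hB, hC, MeteorProcess.MaximalNonCraters, Set.mem_sdiff, Set.mem_union,
        Set.mem_ofPred_eq, MeteorProcess.nonCraters_succ' _ b, hb, hb',
        MeteorProcess.nonCraters_succ _ a]
      tauto
    have h1 := measureReal_inter_add_sdiff₀ (s := A) ((hmeas a (n + 1)).union (hmeas b (n + 1)))
    rw [Set.inter_eq_right.2 (Set.union_subset hBA hCA), ← eq_sub_iff_add_eq'] at h1
    have h2 := measureReal_union_add_inter₀ (s := B) (hmeas b (n + 1))
    rw [hBC] at h2
    rw [hM.measureReal_nonCraters (by omega) hmass hQ (by omega) _,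
      hM.measureReal_nonCraters (by omega) hmass hQ (by omega) _,
      hM.measureReal_nonCraters (by omega) hmass hQ (by omega) _] at h2
    rw [hM.measureReal_nonCraters (by omega) hmass hQ (by omega) _] at h1
    rw [hmax, h1, eq_sub_of_add_eq h2]
    have hf : ((n + 2).factorial : ℝ) ≠ 0 := by positivity
    simp only [Nat.factorial_succ (n + 3), Nat.factorial_succ (n + 2), Nat.cast_mul]
    push_cast
    field_simp
    ring
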